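/- Fix $K\ge 2$ and let $(S_1,\dots,S_K)$ be a random vector of bits that are independent and identically distributed or, more generally, symmetric: for every $m$, the joint law of $(S_{k_1},\dots,S_{k_m})$ is the same for all choices of distinct indices $k_1,\dots,k_m\in\{1,\dots,K\}$. In the $K$-user noiseless binary multicast channel, receiver $k$ observes $Y_k^n=X^n\oplus S_k^n$ (symbolwise addition modulo 2), where the $K$-tuples $(S_{1i},\dots,S_{Ki})$, $i=1,\dots,n$, are independent over time, each with the law of $(S_1,\dots,S_K)$. A code of rate $R\ge 0$ and length $n$ maps a message $W$, uniform on $\{1,\dots,\lceil 2^{nR}\rceil\}$, and the whole array $(S_1^n,\dots,S_K^n)$ to $X^n\in\{0,1\}^n$, and receiver $k$ estimates $W$ from $Y_k^n$ alone. The rate $R$ is achievable if for some sequence of such codes the probability that at least one receiver errs tends to $0$ as $n\to\infty$; the capacity $C$ is the supremum of the achievable rates. Let $H$ denote Shannon entropy in bits. Then $$\max\Big\{1-H(S_1),\;1-\Big(1-\frac1K\Big)H(S_1\oplus S_2)\Big\}\;\le\; C\;\le\; 1-\frac1K\,H(S_1\oplus S_2,\,S_1\oplus S_3,\dots,S_1\oplus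 S_K).$$ Moreover: 1. If, for each $K$, the bits $S_1,\dots,S_K$ are i.i.d. with the law of a fixed random bit $S$, then $C\to 1-H(S)$ as $K\to\infty$. 2. If $K\ge1$ and $S_1,\dots,S_K$ are i.i.d. with $\Pr(S_k=1)=1/2$, then $C=1/K$, and time-sharing is optimal: $1/K$ is also the supremum of the rates achievable by time-sharing codes, that is, codes in which every time slot $i$ is assigned to one receiver $a(i)$, the input has the form $X_i=B_i(W)\oplus S_{a(i),i}$ for a codeword $B^n(W)$ depending on the message only, and each receiver decodes from the outputs in its own slots only. -/

import Mathlib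

open Filter Topology

noncomputable section

namespace BinaryMulticast

/-- Shannon entropy, in bits, of a distribution on a finite alphabet. -/
def entropy {α : Type*} [Fintype α] (p : PMF α) : ℝ :=
  (∑ a, Real.negMulLog (p a).toReal) / Real.log 2

/-- The law of `K` mutually independent bits `S_1, …, S_K`, each with law `q`
(bits are elements of `ZMod 2`, whose addition is exclusive-or). -/
def iidLaw (K : ℕ) (q : PMF (ZMod 2)) : PMF (Fin K → ZMod 2) :=
  PMF.ofFintype (fun s => ∏ k, q (s k)) (by
    rw [← Fintype.prod_sum (fun (_ : Fin K) (x : ZMod 2) => q x)]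
    have h : ∑ x, q x = 1 := by
      rw [← tsum_fintype (L := SummationFilter.unconditional _)]
      exact q.tsum_coe
    simp [h])

/-- The law of `(S_1, …, S_K)` is symmetric: for every `m`, the joint law of
`(S_{k_1}, …, S_{k_m})` does not depend on the choice of the distinct indices
`k_1, …, k_m`. -/
def IsSymmetric {K : ℕ} (p : PMF (Fin K → ZMod 2)) : Prop :=
  ∀ (m : ℕ) (k k' : Fin m → Fin K), Function.Injective k → Function.Injective k' →
    p.map (fun s j => s (k j)) = p.map (fun s j => s (k' j))

/-- A block code of length `n` with `M` messages for `K` receivers. The encoder sees the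
message and the whole `n × K` array of interference bits (`s i k` is the bit of receiver `k`
at time `i`); each decoder sees the output of its own receiver only. -/
structure Code (K n M : ℕ) where
  enc : Fin M → (Fin n → Fin K → ZMod 2) → Fin n → ZMod 2
  dec : Fin K → (Fin n → ZMod 2) → Fin M

/-- The output sequence `Y_k^n = X^n ⊕ S_k^n` of receiver `k`, for message `w` and
interference array `s`. -/
def Code.output {K n M : ℕ} (c : Code K n M) (w : Fin M) (s : Fin n → Fin K → ZMod 2)
    (k : Fin K) : Fin n → ZMod 2 :=
  fun i => c.enc w s i + s i k

/-- The probability that at least one receiver decodes wrongly, for a uniformly distributed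
message and interference `K`-tuples that are i.i.d. over time with law `p`. -/
def Code.errorProb {K n M : ℕ} (c : Code K n M) (p : PMF (Fin K → ZMod 2)) : ℝ :=
  (∑ w : Fin M, ∑ s : Fin n → Fin K → ZMod 2,
    if ∃ k, c.dec k (c.output w s k) ≠ w then ∏ i, (p (s i)).toReal else 0) / M

/-- Time-sharing: each time slot `i` is assigned to one receiver `a i`, whose interference is
precancelled in that slot, and each receiver decodes from its own slots only. -/
def Code.IsTimeSharing {K n M : ℕ} (c : Code K n M) : Prop :=
  ∃ (a : Fin n → Fin K) (b : Fin M → Fin n → ZMod 2),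
    (∀ w s i, c.enc w s i = b w i + s i (a i)) ∧
    ∀ k y y', (∀ i, a i = k → y i = y' i) → c.dec k y = c.dec k y'

/-- The number of messages of a `(2^{nR}, n)` code, `2^{nR}` rounded up. -/
def numMessages (R : ℝ) (n : ℕ) : ℕ := ⌈(2 : ℝ) ^ ((n : ℝ) * R)⌉₊

/-- The rates that are achievable with error probability tending to zero. -/
def achievableRates {K : ℕ} (p : PMF (Fin K → ZMod 2)) : Set ℝ :=
  {R | 0 ≤ R ∧ ∃ c : ∀ n, Code K n (numMessages R n),
    Tendsto (fun n => (c n).errorProb p) atTop (𝓝 0)}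

/-- The rates that are achievable by time-sharing codes. -/
def timeSharingRates {K : ℕ} (p : PMF (Fin K → ZMod 2)) : Set ℝ :=
  {R | 0 ≤ R ∧ ∃ c : ∀ n, Code K n (numMessages R n),
    (∀ n, (c n).IsTimeSharing) ∧ Tendsto (fun n => (c n).errorProb p) atTop (𝓝 0)}

/-- The capacity (in bits per channel use) of the noiseless binary multicast channel with
interference law `p`: the supremum of the achievable rates. -/
def capacity {K : ℕ} (p : PMF (Fin K → ZMod 2)) : ℝ :=
  sSup (achievableRates p)

end BinaryMulticast

end

noncomputable section

namespace BinaryMulticast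

/-! Converse. If every receiver decodes `w`, then each output lies in that receiver's decoding
region for `w`, and adding two outputs cancels the input. The array of differences S_{k₀} ⊕ S_k is
then determined by a point of the product of the K regions, so it takes at most ∏ₖ D_k(w) values,
where D_k(w) is the size of the region (`Code.card_image_good_le`). If the differences have entropy
H nats per slot, a set with N difference arrays has probability at most N·exp(-n(H-δ)) plus an
exponentially small tail (`sum_prod_le_of_image`). A K-th root, the AM-GM inequality and ∑_w D_k(w)
= 2^n bound the success probability by roughly 2^n·exp(-nH/K)/M plus the tail
(`Code.one_sub_errorProb_le`). Above the claimed rate this tends to 0.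

Achievability. Add to the codeword a symbolwise function e_i of the current interference. Receiver k
then sees additive noise e_i(s_i) ⊕ s_{ik}, independent over time but not identically distributed. A
random codebook with threshold decoding works below one minus the per-slot noise entropy of the
worst receiver (`exists_codes`). Taking e = 0 gives 1 - H(S₁); cancelling the receivers'
interference in turn leaves each receiver noiseless for 1/K of the time and gives the other lower
bound.

For i.i.d. bits, conditioning on one of them shows that the differences have entropy at least
(K-1)H(S), so the upper bound is at most 1 - H(S) + H(S)/K. For fair bits this equals 1/K and meets
the precancellation bound; the threshold test then ignores the slots of other receivers, so the code
is a time-sharing code. -/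

/-! ### Laws on finite alphabets -/

/-- The entropy in nats. -/
def natEntropy {α : Type*} [Fintype α] (p : PMF α) : ℝ :=
  ∑ a, Real.negMulLog (p a).toReal

theorem natEntropy_eq {α : Type*} [Fintype α] (p : PMF α) :
    natEntropy p = entropy p * Real.log 2 := by
  have : Real.log 2 ≠ 0 := (Real.log_pos (by norm_num)).ne'
  rw [entropy, natEntropy]
  field_simp

theorem sum_toReal {α : Type*} [Fintype α] (p : PMF α) : ∑ a, (p a).toReal = 1 := by
  rw [← ENNReal.toReal_sum (fun a _ => p.apply_ne_top a),
    ← tsum_fintype (L := SummationFilter.unconditional _), p.tsum_coe, ENNReal.toReal_one]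

theorem toReal_le_one {α : Type*} (p : PMF α) (a : α) : (p a).toReal ≤ 1 :=
  ENNReal.toReal_le_of_le_ofReal zero_le_one (by simpa using p.coe_le_one a)

theorem natEntropy_nonneg {α : Type*} [Fintype α] (p : PMF α) : 0 ≤ natEntropy p :=
  Finset.sum_nonneg fun a _ =>
    Real.negMulLog_nonneg ENNReal.toReal_nonneg (toReal_le_one p a)

theorem toReal_map {α β : Type*} [Fintype α] [DecidableEq β] (p : PMF α) (g : α → β) (b : β) :
    (p.map g b).toReal = ∑ a, if g a = b then (p a).toReal else 0 := by
  rw [PMF.map_apply, tsum_fintype, ENNReal.toReal_sum]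
  · refine Finset.sum_congr rfl fun a _ => ?_
    by_cases h : g a = b
    · simp [h]
    · simp [h, Ne.symm h]
  · intro a _
    split_ifs
    · exact p.apply_ne_top a
    · simp

theorem sum_toReal_map_mul {α β : Type*} [Fintype α] [Fintype β] (p : PMF α)
    (g : α → β) (F : β → ℝ) :
    ∑ b, (p.map g b).toReal * F b = ∑ a, (p a).toReal * F (g a) := by
  classical
  simp_rw [toReal_map, Finset.sum_mul]
  rw [Finset.sum_comm]
  refine Finset.sum_congr rfl fun a _ => ?_
  simp [ite_mul]

theorem toReal_le_toReal_map {α β : Type*} [Fintype α] (p : PMF α)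
    (g : α → β) (a : α) : (p a).toReal ≤ (p.map g (g a)).toReal := by
  classical
  rw [toReal_map]
  calc (p a).toReal = if g a = g a then (p a).toReal else 0 := by simp
    _ ≤ _ := Finset.single_le_sum
      (f := fun a' => if g a' = g a then (p a').toReal else 0)
      (fun a' _ => by split_ifs <;> simp) (Finset.mem_univ a)

/-! ### Concentration and typical sequences -/

/-- The deviation of the log-likelihood from its mean. -/
def logDev {α : Type*} [Fintype α] (p : PMF α) (a : α) : ℝ :=
  Real.log (p a).toReal + natEntropy p

theorem sum_mul_logDev {α : Type*} [Fintype α] (p : PMF α) :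
    ∑ a, (p a).toReal * logDev p a = 0 := by
  simp_rw [logDev, mul_add, Finset.sum_add_distrib, ← Finset.sum_mul, sum_toReal, natEntropy,
    Real.negMulLog, one_mul, neg_mul, Finset.sum_neg_distrib]
  ring

theorem sum_prod_toReal {ι α : Type*} [Fintype ι] [Fintype α] [DecidableEq ι] (p : ι → PMF α) :
    ∑ s : ι → α, ∏ i, (p i (s i)).toReal = 1 := by
  rw [← Fintype.prod_sum (fun i a => (p i a).toReal)]
  simp [sum_toReal]

/-- A Chernoff bound for sums of independent bounded variables with nonpositive means. -/
theorem chernoff {ι α : Type*} [Fintype ι] [Fintype α] [DecidableEq ι] (p : PMF α)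
    (X : ι → α → ℝ) {B δ : ℝ} (hδ : 0 < δ) (hB : δ ≤ B) (hX : ∀ i a, |X i a| ≤ B)
    (hmean : ∀ i, ∑ a, (p a).toReal * X i a ≤ 0) :
    (∑ s : ι → α, if Fintype.card ι * δ ≤ ∑ i, X i (s i) then ∏ i, (p (s i)).toReal else 0) ≤
      Real.exp (-(Fintype.card ι * (δ ^ 2 / (4 * B ^ 2)))) := by
  have hB0 : 0 < B := hδ.trans_le hB
  -- This minimises -tδ + t²B², with value -δ²/(4B²). It also gives tB ≤ 1, the range in which exp x
  -- ≤ 1 + x + x² is applied.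
  set t : ℝ := δ / (2 * B ^ 2) with ht
  have ht0 : 0 < t := by positivity
  have htB : t * B ≤ 1 := by
    rw [ht, div_mul_eq_mul_div, div_le_one (by positivity)]
    nlinarith
  have hmgf : ∀ i, ∑ a, (p a).toReal * Real.exp (t * X i a) ≤ Real.exp (t ^ 2 * B ^ 2) := by
    intro i
    have h1 : ∀ a, Real.exp (t * X i a) ≤ 1 + t * X i a + t ^ 2 * B ^ 2 := by
      intro a
      have hab : |t * X i a| ≤ t * B := by
        rw [abs_mul, abs_of_pos ht0]
        exact mul_le_mul_of_nonneg_left (hX i a) ht0.le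
      have h2 := (abs_le.1 (Real.abs_exp_sub_one_sub_id_le (hab.trans htB))).2
      have h3 : (t * X i a) ^ 2 ≤ (t * B) ^ 2 := sq_le_sq' (abs_le.1 hab).1 (abs_le.1 hab).2
      nlinarith
    calc ∑ a, (p a).toReal * Real.exp (t * X i a)
        ≤ ∑ a, (p a).toReal * (1 + t * X i a + t ^ 2 * B ^ 2) :=
          Finset.sum_le_sum fun a _ => mul_le_mul_of_nonneg_left (h1 a) ENNReal.toReal_nonneg
      _ = (∑ a, (p a).toReal) * (1 + t ^ 2 * B ^ 2) + t * ∑ a, (p a).toReal * X i a := by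
          rw [Finset.sum_mul, Finset.mul_sum, ← Finset.sum_add_distrib]
          exact Finset.sum_congr rfl fun a _ => by ring
      _ ≤ t ^ 2 * B ^ 2 + 1 := by
          rw [sum_toReal]
          nlinarith [hmean i]
      _ ≤ _ := Real.add_one_le_exp _
  calc _ ≤ ∑ s : ι → α, Real.exp (-(t * (Fintype.card ι * δ))) *
        ∏ i, ((p (s i)).toReal * Real.exp (t * X i (s i))) := by
        refine Finset.sum_le_sum fun s _ => ?_
        rw [Finset.prod_mul_distrib, ← Real.exp_sum, ← Finset.mul_sum, mul_left_comm,
          ← Real.exp_add]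
        have h0 : 0 ≤ ∏ i, (p (s i)).toReal := Finset.prod_nonneg fun _ _ => ENNReal.toReal_nonneg
        split_ifs with h
        · refine le_mul_of_one_le_right h0 (Real.one_le_exp ?_)
          nlinarith
        · positivity
    _ = Real.exp (-(t * (Fintype.card ι * δ))) *
        ∏ i, ∑ a, (p a).toReal * Real.exp (t * X i a) := by
        rw [← Finset.mul_sum, Fintype.prod_sum]
    _ ≤ Real.exp (-(t * (Fintype.card ι * δ))) * ∏ _i : ι, Real.exp (t ^ 2 * B ^ 2) := by
        refine mul_le_mul_of_nonneg_left (Finset.prod_le_prod ?_ fun i _ => hmgf i) (by positivity)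
        exact fun i _ => Finset.sum_nonneg fun a _ =>
          mul_nonneg ENNReal.toReal_nonneg (Real.exp_nonneg _)
    _ = _ := by
        rw [← Real.exp_sum, ← Real.exp_add, Finset.sum_const, Finset.card_univ, nsmul_eq_mul]
        congr 1
        rw [ht]
        field_simp
        ring

/-- The law of a tuple obtained symbolwise from independent symbols. -/
theorem sum_prod_fiber {ι α β : Type*} [Fintype ι] [Fintype α] [DecidableEq ι] [DecidableEq β]
    (p : PMF α) (g : ι → α → β) (d : ι → β) :
    (∑ s : ι → α, if (fun i => g i (s i)) = d then ∏ i, (p (s i)).toReal else 0) =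
      ∏ i, (p.map (g i) (d i)).toReal := by
  simp_rw [toReal_map]
  rw [Fintype.prod_sum]
  refine Finset.sum_congr rfl fun s _ => ?_
  split_ifs with h
  · subst h
    simp
  · obtain ⟨i, hi⟩ := Function.ne_iff.1 h
    exact (Finset.prod_eq_zero (Finset.mem_univ i) (if_neg hi)).symm

/-- A product of probabilities is the exponential of the sum of the log-likelihoods. -/
theorem prod_toReal_eq_exp {ι β : Type*} [Fintype ι] [Fintype β] (μ : ι → PMF β) (z : ι → β)
    (h : ∀ i, (μ i (z i)).toReal ≠ 0) :
    ∏ i, (μ i (z i)).toReal = Real.exp (∑ i, logDev (μ i) (z i) - ∑ i, natEntropy (μ i)) := by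
  simp_rw [logDev, Finset.sum_add_distrib, add_sub_cancel_right, Real.exp_sum]
  exact Finset.prod_congr rfl fun i _ =>
    (Real.exp_log (lt_of_le_of_ne ENNReal.toReal_nonneg (h i).symm)).symm

/-- Symbols of probability zero do no harm, since `Real.log 0 = 0`. -/
theorem exists_logDev_bound {α : Type*} [Fintype α] (p : PMF α) (δ : ℝ) :
    ∃ B, δ ≤ B ∧ ∀ a, |logDev p a| ≤ B := by
  refine ⟨max δ (∑ a, |logDev p a|), le_max_left _ _, fun a => le_max_of_le_right ?_⟩
  exact Finset.single_le_sum (f := fun a => |logDev p a|) (fun _ _ => abs_nonneg _)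
    (Finset.mem_univ a)

/-- A set of sequences with few images has small probability, up to atypical sequences. -/
theorem sum_prod_le_of_image {ι α β : Type*} [Fintype ι] [DecidableEq ι] [Fintype α] [Fintype β]
    [DecidableEq β] (p : PMF α) (g : α → β) (A : Finset (ι → α)) {B δ : ℝ} (hδ : 0 < δ)
    (hB : δ ≤ B) (hX : ∀ b, |logDev (p.map g) b| ≤ B) :
    ∑ s ∈ A, ∏ i, (p (s i)).toReal ≤
      Real.exp (-(Fintype.card ι * (δ ^ 2 / (4 * B ^ 2)))) +
      (A.image fun s i => g (s i)).card *
        Real.exp (-(Fintype.card ι * (natEntropy (p.map g) - δ))) := by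
  set r := p.map g with hr
  have hP : ∀ s : ι → α, 0 ≤ ∏ i, (p (s i)).toReal :=
    fun s => Finset.prod_nonneg fun _ _ => ENNReal.toReal_nonneg
  have htail := chernoff (ι := ι) p (fun _ a => logDev r (g a)) hδ hB (fun _ a => hX (g a))
    (fun _ => by rw [← sum_toReal_map_mul p g (logDev r), ← hr, sum_mul_logDev])
  set G : (ι → α) → ι → β := fun s i => g (s i) with hG
  set tail : (ι → β) → Prop := fun d => Fintype.card ι * δ ≤ ∑ i, logDev r (d i) with htl
  have hbulk : ∑ s ∈ A, (if tail (G s) then 0 else ∏ i, (p (s i)).toReal) ≤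
      (A.image G).card * Real.exp (-(Fintype.card ι * (natEntropy r - δ))) := by
    calc _ ≤ ∑ d ∈ A.image G, ∑ s : ι → α,
          (if tail d then 0 else if G s = d then ∏ i, (p (s i)).toReal else 0) := by
          have hnn : ∀ d s, 0 ≤
              (if tail d then 0 else if G s = d then ∏ i, (p (s i)).toReal else 0) := by
            intro d s
            split_ifs
            exacts [le_rfl, hP s, le_rfl]
          refine le_trans ?_ (Finset.sum_le_sum fun d _ =>
            Finset.sum_le_sum_of_subset_of_nonneg (Finset.subset_univ A) fun s _ _ => hnn d s)
          rw [Finset.sum_comm]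
          refine Finset.sum_le_sum fun s hs => ?_
          have := Finset.single_le_sum (fun d _ => hnn d s) (Finset.mem_image_of_mem G hs)
          simpa using this
      _ ≤ ∑ _d ∈ A.image G, Real.exp (-(Fintype.card ι * (natEntropy r - δ))) := by
          refine Finset.sum_le_sum fun d _ => ?_
          by_cases hd : tail d
          · simp [hd, Real.exp_nonneg]
          simp only [hd, if_false]
          rw [sum_prod_fiber p (fun _ => g) d]
          -- At a null symbol the convention `Real.log 0 = 0` breaks the exponential formula, but
          -- there the product itself vanishes.
          by_cases h0 : ∀ i, (r (d i)).toReal ≠ 0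
          · rw [prod_toReal_eq_exp (fun _ => r) d h0, Finset.sum_const, Finset.card_univ,
              nsmul_eq_mul]
            refine Real.exp_le_exp.2 ?_
            simp only [htl, not_le] at hd
            linarith
          · push Not at h0
            obtain ⟨i, hi⟩ := h0
            rw [Finset.prod_eq_zero (Finset.mem_univ i) hi]
            positivity
      _ = _ := by rw [Finset.sum_const, nsmul_eq_mul]
  calc ∑ s ∈ A, ∏ i, (p (s i)).toReal
      = ∑ s ∈ A, (if tail (G s) then ∏ i, (p (s i)).toReal else 0) +
        ∑ s ∈ A, (if tail (G s) then 0 else ∏ i, (p (s i)).toReal) := by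
        rw [← Finset.sum_add_distrib]
        exact Finset.sum_congr rfl fun s _ => by split_ifs <;> simp
    _ ≤ _ := by
        refine add_le_add (le_trans ?_ htail) hbulk
        refine Finset.sum_le_sum_of_subset_of_nonneg (Finset.subset_univ _) fun s _ _ => ?_
        split_ifs
        exacts [hP s, le_rfl]

/-- For x ≤ 1 the power only increases x; for x ≥ 1 it is at least 1, which already bounds a
probability. This allows the K-th root in the converse without touching the tail term. -/
theorem le_add_rpow_of_le {S t x e : ℝ} (ht : 0 ≤ t) (hx : 0 ≤ x) (h1 : S ≤ 1) (h : S ≤ t + x)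
    (he0 : 0 ≤ e) (he1 : e ≤ 1) : S ≤ t + x ^ e := by
  rcases le_total x 1 with hx1 | hx1
  · have := Real.rpow_le_rpow_of_exponent_ge' hx hx1 he0 he1
    rw [Real.rpow_one] at this
    linarith
  · have := Real.one_le_rpow hx1 he0
    linarith

/-! ### The converse -/

/-- The interference arrays for which all receivers decode the message `w`. -/
def Code.good {K n M : ℕ} (c : Code K n M) (w : Fin M) : Finset (Fin n → Fin K → ZMod 2) :=
  {s | ∀ k, c.dec k (c.output w s k) = w}

theorem Code.one_sub_errorProb {K n M : ℕ} (c : Code K n M) (p : PMF (Fin K → ZMod 2))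
    (hM : 0 < M) :
    1 - c.errorProb p = (∑ w, ∑ s ∈ c.good w, ∏ i, (p (s i)).toReal) / M := by
  have hM' : (M : ℝ) ≠ 0 := by positivity
  rw [eq_div_iff hM', Code.errorProb, sub_mul, div_mul_cancel₀ _ hM', sub_eq_iff_eq_add,
    ← Finset.sum_add_distrib]
  have hsum : (1 : ℝ) * M = ∑ _w : Fin M, 1 := by simp
  rw [hsum]
  refine Finset.sum_congr rfl fun w _ => ?_
  rw [← sum_prod_toReal (fun _ : Fin n => p), Code.good, Finset.sum_filter,
    ← Finset.sum_add_distrib]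
  refine Finset.sum_congr rfl fun s _ => ?_
  by_cases h : ∀ k, c.dec k (c.output w s k) = w
  · simp [h]
  · rw [if_neg h, if_pos (not_forall.1 h), zero_add]

/-- The input cancels in the sum of two outputs, so the differences of the interference are
differences of outputs, each of which lies in a decoding region of `w`. -/
theorem Code.card_image_good_le {K n M : ℕ} (c : Code K n M) (k₀ : Fin K) (w : Fin M) :
    ((c.good w).image fun s i (k : {k // k ≠ k₀}) => s i k₀ + s i k).card ≤
      ∏ k, (Finset.univ.filter fun y => c.dec k y = w).card := by
  rw [← Fintype.card_piFinset]
  refine (Finset.card_le_card ?_).trans (Finset.card_image_le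
    (f := fun y i (k : {k // k ≠ k₀}) => y k₀ i + y k i))
  intro d hd
  obtain ⟨s, hs, rfl⟩ := Finset.mem_image.1 hd
  simp only [Code.good, Finset.mem_filter, Finset.mem_univ, true_and] at hs
  refine Finset.mem_image.2 ⟨fun k => c.output w s k, ?_, ?_⟩
  · simpa [Fintype.mem_piFinset] using hs
  · funext i k
    simp only [Code.output]
    rw [add_add_add_comm, CharTwo.add_self_eq_zero, zero_add]

/-- The decoding regions of one receiver partition the output space. -/
theorem Code.sum_card_dec {K n M : ℕ} (c : Code K n M) (k : Fin K) :
    ∑ w, ((Finset.univ.filter fun y => c.dec k y = w).card : ℝ) = 2 ^ n := by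
  have h := Finset.card_eq_sum_card_fiberwise (f := c.dec k) (s := Finset.univ)
    (t := Finset.univ) (fun _ _ => by simp)
  have h2 : (Finset.univ : Finset (Fin n → ZMod 2)).card = 2 ^ n := by
    rw [Finset.card_univ, Fintype.card_fun, ZMod.card, Fintype.card_fin]
  rw [h2] at h
  exact_mod_cast h.symm

/-- An upper bound on the probability that all receivers decode correctly. -/
theorem Code.one_sub_errorProb_le {K n M : ℕ} (c : Code K n M) (k₀ : Fin K)
    (p : PMF (Fin K → ZMod 2)) (hM : 0 < M) {B δ : ℝ} (hδ : 0 < δ) (hB : δ ≤ B)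
    (hX : ∀ b, |logDev (p.map fun s (k : {k // k ≠ k₀}) => s k₀ + s k) b| ≤ B) :
    1 - c.errorProb p ≤ Real.exp (-(n * (δ ^ 2 / (4 * B ^ 2)))) +
      Real.exp (-(n * (natEntropy (p.map fun s (k : {k // k ≠ k₀}) => s k₀ + s k) - δ)) *
        (1 / K)) * 2 ^ n / M := by
  set g : (Fin K → ZMod 2) → {k // k ≠ k₀} → ZMod 2 := fun s k => s k₀ + s k with hg
  set H := natEntropy (p.map g) with hH
  have hK : 0 < K := k₀.pos
  have hK' : (0 : ℝ) < K := by exact_mod_cast hK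
  have hM' : (0 : ℝ) < M := by exact_mod_cast hM
  set t := Real.exp (-(n * (δ ^ 2 / (4 * B ^ 2)))) with ht
  set D : Fin K → Fin M → ℝ := fun k w => ((Finset.univ.filter fun y => c.dec k y = w).card : ℝ)
    with hD
  have hD0 : ∀ k w, 0 ≤ D k w := fun k w => Nat.cast_nonneg _
  set τ := Real.exp (-(n * (H - δ))) with hτ
  have hw : ∀ w, ∑ s ∈ c.good w, ∏ i, (p (s i)).toReal ≤
      t + τ ^ (1 / (K : ℝ)) * ∑ k, (1 / (K : ℝ)) * D k w := by
    intro w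
    have h1 : ∑ s ∈ c.good w, ∏ i, (p (s i)).toReal ≤ 1 := by
      rw [← sum_prod_toReal (fun _ : Fin n => p)]
      exact Finset.sum_le_sum_of_subset_of_nonneg (Finset.subset_univ _) fun s _ _ =>
        Finset.prod_nonneg fun _ _ => ENNReal.toReal_nonneg
    have h2 : ∑ s ∈ c.good w, ∏ i, (p (s i)).toReal ≤ t + (∏ k, D k w) * τ := by
      have h := sum_prod_le_of_image p g (c.good w) hδ hB hX
      rw [Fintype.card_fin] at h
      refine h.trans (add_le_add le_rfl (mul_le_mul_of_nonneg_right ?_ (Real.exp_nonneg _)))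
      have h' := c.card_image_good_le k₀ w
      simp only [hD]
      exact_mod_cast h'
    have h0 : 0 ≤ ∏ k, D k w := Finset.prod_nonneg fun k _ => hD0 k w
    have h3 := le_add_rpow_of_le (e := 1 / (K : ℝ)) (Real.exp_nonneg _)
      (mul_nonneg h0 (Real.exp_nonneg _)) h1 h2 (by positivity)
      (by rw [div_le_one hK']; exact_mod_cast hK)
    refine h3.trans (add_le_add le_rfl ?_)
    rw [Real.mul_rpow h0 (Real.exp_nonneg _), mul_comm,
      ← Real.finsetProd_rpow _ _ fun k _ => hD0 k w]
    refine mul_le_mul_of_nonneg_left ?_ (by positivity)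
    -- AM-GM makes the bound linear in the region sizes, so that it can be summed over messages.
    refine Real.geom_mean_le_arith_mean_weighted _ _ _ (fun _ _ => by positivity) ?_
      fun k _ => hD0 k w
    rw [Finset.sum_const, Finset.card_univ, Fintype.card_fin, nsmul_eq_mul]
    field_simp
  rw [c.one_sub_errorProb p hM, div_le_iff₀ hM']
  calc _ ≤ ∑ w, (t + τ ^ (1 / (K : ℝ)) * ∑ k, (1 / (K : ℝ)) * D k w) :=
        Finset.sum_le_sum fun w _ => hw w
    _ = t * M + τ ^ (1 / (K : ℝ)) * 2 ^ n := by
        rw [Finset.sum_add_distrib, Finset.sum_const, Finset.card_univ, Fintype.card_fin,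
          nsmul_eq_mul, ← Finset.mul_sum, Finset.sum_comm]
        simp_rw [← Finset.mul_sum, hD, c.sum_card_dec]
        rw [Finset.sum_const, Finset.card_univ, Fintype.card_fin, nsmul_eq_mul]
        field_simp
    _ = _ := by
        rw [hτ, ← Real.exp_mul]
        field_simp

theorem tendsto_exp_neg_nat_mul {c : ℝ} (hc : 0 < c) :
    Tendsto (fun n : ℕ => Real.exp (-(n * c))) atTop (𝓝 0) :=
  Real.tendsto_exp_neg_atTop_nhds_zero.comp
    (tendsto_natCast_atTop_atTop.atTop_mul_const hc)

theorem two_rpow_eq_exp (x : ℝ) : (2 : ℝ) ^ x = Real.exp (x * Real.log 2) := by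
  rw [Real.rpow_def_of_pos two_pos, mul_comm]

theorem numMessages_pos (R : ℝ) (n : ℕ) : 0 < numMessages R n :=
  Nat.ceil_pos.2 (Real.rpow_pos_of_pos two_pos _)

/-- The converse: a bound on all achievable rates. -/
theorem le_of_mem_achievableRates {K : ℕ} (k₀ : Fin K) {p : PMF (Fin K → ZMod 2)} {R : ℝ}
    (hR : R ∈ achievableRates p) :
    R ≤ 1 - 1 / (K : ℝ) * entropy (p.map fun s (k : {k // k ≠ k₀}) => s k₀ + s k) := by
  obtain ⟨-, c, hc⟩ := hR
  by_contra! hlt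
  have hK : (0 : ℝ) < K := by exact_mod_cast k₀.pos
  have hl : 0 < Real.log 2 := Real.log_pos (by norm_num)
  set r := p.map fun s (k : {k // k ≠ k₀}) => s k₀ + s k with hr
  set γ := R * Real.log 2 + natEntropy r / K - Real.log 2 with hγ
  have hγ0 : 0 < γ := by
    have := mul_lt_mul_of_pos_right hlt hl
    rw [natEntropy_eq] at hγ
    rw [hγ]
    have e : (1 - 1 / (K : ℝ) * entropy r) * Real.log 2 =
      Real.log 2 - entropy r * Real.log 2 / K := by ring
    linarith
  -- The K-th root turns the slack δ into δ/K = γ/2, half of the excess rate γ.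
  set δ := γ * K / 2 with hδ
  have hδ0 : 0 < δ := by positivity
  obtain ⟨B, hB, hX⟩ := exists_logDev_bound r δ
  have hB0 : 0 < B := hδ0.trans_le hB
  have hbound : ∀ n, 1 - (c n).errorProb p ≤ Real.exp (-(n * (δ ^ 2 / (4 * B ^ 2)))) +
      Real.exp (-(n * (γ / 2))) := by
    intro n
    refine ((c n).one_sub_errorProb_le k₀ p (numMessages_pos R n) hδ0 hB hX).trans
      (add_le_add le_rfl ?_)
    have hM : Real.exp (n * R * Real.log 2) ≤ numMessages R n := by
      rw [← two_rpow_eq_exp]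
      exact Nat.le_ceil _
    rw [div_le_iff₀ (by exact_mod_cast numMessages_pos R n)]
    refine le_trans (le_of_eq ?_) (mul_le_mul_of_nonneg_left hM (Real.exp_nonneg _))
    rw [← Real.rpow_natCast, two_rpow_eq_exp, ← Real.exp_add, ← Real.exp_add]
    congr 1
    rw [hδ, hγ]
    field_simp
    ring
  have h1 : Tendsto (fun n => 1 - (c n).errorProb p) atTop (𝓝 (1 - 0)) :=
    tendsto_const_nhds.sub hc
  have h2 := (tendsto_exp_neg_nat_mul (c := δ ^ 2 / (4 * B ^ 2)) (by positivity)).add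
    (tendsto_exp_neg_nat_mul (c := γ / 2) (by positivity))
  have := le_of_tendsto_of_tendsto' h1 h2 hbound
  norm_num at this

/-! ### Random coding with threshold decoding -/

/-- An element satisfying `P`, or `w₀` if there is none. -/
def pick {α : Type*} (w₀ : α) (P : α → Prop) : α :=
  open Classical in if h : ∃ w, P w then h.choose else w₀

theorem pick_spec {α : Type*} (w₀ : α) {P : α → Prop} (h : ∃ w, P w) : P (pick w₀ P) := by
  rw [pick, dif_pos h]
  exact h.choose_spec

/-- The code with codebook `b`, symbolwise precancellation `e`, and decoders that look for a
codeword whose difference from the output lies in a prescribed set. -/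
def thresholdCode {K n M : ℕ} (e : Fin n → (Fin K → ZMod 2) → ZMod 2)
    (T : Fin K → Finset (Fin n → ZMod 2)) (w₀ : Fin M) (b : Fin M → Fin n → ZMod 2) :
    Code K n M where
  enc w s i := b w i + e i (s i)
  dec k y := pick w₀ fun w => y - b w ∈ T k

/-- The noise that remains at receiver `k`. -/
def residual {K n : ℕ} (e : Fin n → (Fin K → ZMod 2) → ZMod 2) (s : Fin n → Fin K → ZMod 2)
    (k : Fin K) : Fin n → ZMod 2 := fun i => e i (s i) + s i k

theorem thresholdCode_output {K n M : ℕ} (e : Fin n → (Fin K → ZMod 2) → ZMod 2)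
    (T : Fin K → Finset (Fin n → ZMod 2)) (w₀ : Fin M) (b : Fin M → Fin n → ZMod 2)
    (w : Fin M) (s : Fin n → Fin K → ZMod 2) (k : Fin K) :
    (thresholdCode e T w₀ b).output w s k = b w + residual e s k := by
  funext i
  simp [Code.output, thresholdCode, residual, add_assoc]

/-- If the noise passes the test and no other message does, the decoder has only `w` to pick. -/
theorem thresholdCode_error {K n M : ℕ} (e : Fin n → (Fin K → ZMod 2) → ZMod 2)
    (T : Fin K → Finset (Fin n → ZMod 2)) (w₀ : Fin M) (b : Fin M → Fin n → ZMod 2)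
    (w : Fin M) (s : Fin n → Fin K → ZMod 2) (k : Fin K)
    (h : (thresholdCode e T w₀ b).dec k ((thresholdCode e T w₀ b).output w s k) ≠ w) :
    residual e s k ∉ T k ∨ ∃ w', w' ≠ w ∧ b w + residual e s k - b w' ∈ T k := by
  rw [thresholdCode_output] at h
  by_contra! hcon
  apply h
  have hex : ∃ w', b w + residual e s k - b w' ∈ T k := ⟨w, by simpa using hcon.1⟩
  by_contra hne
  exact hcon.2 _ hne (pick_spec w₀ hex)

/-- Pairwise independence in a uniformly random codebook. -/
theorem sum_codebook_mem {n M : ℕ} (T : Finset (Fin n → ZMod 2)) (z : Fin n → ZMod 2)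
    {w w' : Fin M} (hw : w' ≠ w) :
    (∑ b : Fin M → Fin n → ZMod 2, if b w + z - b w' ∈ T then (1 : ℝ) else 0) =
      Fintype.card (Fin M → Fin n → ZMod 2) * (T.card / 2 ^ n) := by
  have hcard : (Fintype.card (Fin n → ZMod 2) : ℝ) = 2 ^ n := by
    rw [Fintype.card_fun, ZMod.card, Fintype.card_fin]
    push_cast
    rfl
  -- Translating codeword `w` by v permutes the codebooks and leaves codeword `w'` alone; averaging
  -- over v makes the tested difference uniform.
  have hshift : ∀ v : Fin n → ZMod 2,
      (∑ b : Fin M → Fin n → ZMod 2, if b w + z - b w' ∈ T then (1 : ℝ) else 0) =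
      ∑ b : Fin M → Fin n → ZMod 2, if (b w + z - b w') + v ∈ T then (1 : ℝ) else 0 := by
    intro v
    rw [← Equiv.sum_comp (Equiv.addRight (Pi.single w v : Fin M → Fin n → ZMod 2))]
    refine Finset.sum_congr rfl fun b _ => ?_
    have : (Equiv.addRight (Pi.single w v : Fin M → Fin n → ZMod 2)) b w + z -
        (Equiv.addRight (Pi.single w v : Fin M → Fin n → ZMod 2)) b w' =
        (b w + z - b w') + v := by
      simp only [Equiv.coe_addRight, Pi.add_apply, Pi.single_eq_same, Pi.single_eq_of_ne hw,
        add_zero]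
      abel
    rw [this]
  have hv : ∀ c : Fin n → ZMod 2, (∑ v, if c + v ∈ T then (1 : ℝ) else 0) = T.card := by
    intro c
    refine (Equiv.sum_comp (Equiv.addLeft c) (fun v => if v ∈ T then (1 : ℝ) else 0)).trans ?_
    simp
  have htot : (2 : ℝ) ^ n *
      (∑ b : Fin M → Fin n → ZMod 2, if b w + z - b w' ∈ T then (1 : ℝ) else 0) =
      Fintype.card (Fin M → Fin n → ZMod 2) * T.card := by
    rw [← hcard, ← nsmul_eq_mul, ← Finset.card_univ, ← Finset.sum_const,
      Finset.sum_congr rfl fun v _ => hshift v, Finset.sum_comm,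
      Finset.sum_congr rfl fun b _ => hv _, Finset.sum_const, nsmul_eq_mul, Finset.card_univ]
  rw [mul_div_assoc', eq_div_iff (by positivity), mul_comm, htot]

theorem sum_codebook_error {K n M : ℕ} (e : Fin n → (Fin K → ZMod 2) → ZMod 2)
    (T : Fin K → Finset (Fin n → ZMod 2)) (w₀ : Fin M) (w : Fin M)
    (s : Fin n → Fin K → ZMod 2) (k : Fin K) :
    (∑ b : Fin M → Fin n → ZMod 2,
      if (thresholdCode e T w₀ b).dec k ((thresholdCode e T w₀ b).output w s k) ≠ w
        then (1 : ℝ) else 0) ≤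
      Fintype.card (Fin M → Fin n → ZMod 2) *
        ((if residual e s k ∉ T k then 1 else 0) + M * ((T k).card / 2 ^ n)) := by
  set z := residual e s k with hz
  calc _ ≤ ∑ b : Fin M → Fin n → ZMod 2, ((if z ∉ T k then (1 : ℝ) else 0) +
        ∑ w', if w' ≠ w ∧ b w + z - b w' ∈ T k then (1 : ℝ) else 0) := by
        refine Finset.sum_le_sum fun b _ => ?_
        have hnn : ∀ w' ∈ (Finset.univ : Finset (Fin M)),
            (0 : ℝ) ≤ if w' ≠ w ∧ b w + z - b w' ∈ T k then (1 : ℝ) else 0 :=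
          fun w' _ => by split_ifs <;> norm_num
        have hnn' := Finset.sum_nonneg hnn
        have hz0 : (0 : ℝ) ≤ if z ∉ T k then (1 : ℝ) else 0 := by split_ifs <;> norm_num
        by_cases h : (thresholdCode e T w₀ b).dec k ((thresholdCode e T w₀ b).output w s k) ≠ w
        · rw [if_pos h]
          rcases thresholdCode_error e T w₀ b w s k h with h1 | ⟨w', hw', h1⟩
          · rw [← hz] at h1
            rw [if_pos h1]
            linarith
          · have := Finset.single_le_sum hnn (Finset.mem_univ w')
            rw [if_pos ⟨hw', h1⟩] at this
            linarith
        · rw [if_neg h]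
          linarith
    _ ≤ _ := by
        rw [Finset.sum_add_distrib, Finset.sum_const, Finset.card_univ, nsmul_eq_mul, mul_add,
          Finset.sum_comm]
        refine add_le_add le_rfl ?_
        calc _ ≤ ∑ _w' : Fin M,
              (Fintype.card (Fin M → Fin n → ZMod 2) * ((T k).card / 2 ^ n) : ℝ) := by
              refine Finset.sum_le_sum fun w' _ => ?_
              by_cases hw' : w' = w
              · simp only [hw', ne_eq, not_true, false_and, if_false, Finset.sum_const_zero]
                positivity
              · simp only [ne_eq, hw', not_false_eq_true, true_and]
                exact (sum_codebook_mem (T k) z hw').le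
          _ = _ := by
              rw [Finset.sum_const, Finset.card_univ, Fintype.card_fin, nsmul_eq_mul]
              ring

/-- Random coding: some codebook has small error probability. -/
theorem exists_codebook {K n M : ℕ} (p : PMF (Fin K → ZMod 2))
    (e : Fin n → (Fin K → ZMod 2) → ZMod 2)
    (T : Fin K → Finset (Fin n → ZMod 2)) (w₀ : Fin M) :
    ∃ b, (thresholdCode e T w₀ b).errorProb p ≤
      ∑ k, ((∑ s : Fin n → Fin K → ZMod 2,
          if residual e s k ∉ T k then ∏ i, (p (s i)).toReal else 0) +
        M * ((T k).card / 2 ^ n)) := by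
  have hM' : (0 : ℝ) < M := by exact_mod_cast w₀.pos
  set P : (Fin n → Fin K → ZMod 2) → ℝ := fun s => ∏ i, (p (s i)).toReal with hP
  have hP0 : ∀ s, 0 ≤ P s := fun s => Finset.prod_nonneg fun _ _ => ENNReal.toReal_nonneg
  have hP1 : ∑ s, P s = 1 := sum_prod_toReal (fun _ : Fin n => p)
  set rhs := ∑ k, ((∑ s : Fin n → Fin K → ZMod 2, if residual e s k ∉ T k then P s else 0) +
        M * ((T k).card / 2 ^ n)) with hrhs
  set err : (Fin M → Fin n → ZMod 2) → Fin M → (Fin n → Fin K → ZMod 2) → Fin K → ℝ :=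
    fun b w s k => if (thresholdCode e T w₀ b).dec k ((thresholdCode e T w₀ b).output w s k) ≠ w
        then (1 : ℝ) else 0 with herr
  have hle : ∀ b, (thresholdCode e T w₀ b).errorProb p ≤ (∑ w, ∑ s, ∑ k, P s * err b w s k) / M := by
    intro b
    refine div_le_div_of_nonneg_right (Finset.sum_le_sum fun w _ =>
      Finset.sum_le_sum fun s _ => ?_) hM'.le
    have hnn : ∀ k ∈ Finset.univ, 0 ≤ P s * err b w s k := fun k _ =>
      mul_nonneg (hP0 s) (by simp only [herr]; split_ifs <;> norm_num)
    split_ifs with h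
    · obtain ⟨k, hk⟩ := h
      have := Finset.single_le_sum hnn (Finset.mem_univ k)
      simpa only [herr, if_pos hk, mul_one] using this
    · exact Finset.sum_nonneg hnn
  have hsum : ∑ b, (thresholdCode e T w₀ b).errorProb p ≤
      ∑ _b : Fin M → Fin n → ZMod 2, rhs := by
    set N : ℝ := ((Fintype.card (Fin M → Fin n → ZMod 2) : ℕ) : ℝ) with hN
    calc _ ≤ ∑ b, (∑ w, ∑ s, ∑ k, P s * err b w s k) / M := Finset.sum_le_sum fun b _ => hle b
      _ = (∑ w, ∑ s, ∑ k, P s * ∑ b, err b w s k) / M := by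
          rw [← Finset.sum_div, Finset.sum_comm]
          congr 1
          refine Finset.sum_congr rfl fun w _ => ?_
          rw [Finset.sum_comm]
          refine Finset.sum_congr rfl fun s _ => ?_
          rw [Finset.sum_comm]
          exact Finset.sum_congr rfl fun k _ => by rw [Finset.mul_sum]
      _ ≤ (∑ _w : Fin M, ∑ s, ∑ k, P s * (N * ((if residual e s k ∉ T k then 1 else 0) +
            M * ((T k).card / 2 ^ n)))) / M := by
          refine div_le_div_of_nonneg_right (Finset.sum_le_sum fun w _ =>
            Finset.sum_le_sum fun s _ => Finset.sum_le_sum fun k _ => ?_) hM'.le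
          exact mul_le_mul_of_nonneg_left (sum_codebook_error e T w₀ w s k) (hP0 s)
      _ = N * rhs := by
          rw [Finset.sum_const, Finset.card_univ, Fintype.card_fin, nsmul_eq_mul,
            mul_div_cancel_left₀ _ hM'.ne', Finset.sum_comm, hrhs, Finset.mul_sum]
          refine Finset.sum_congr rfl fun k _ => ?_
          calc _ = N * (∑ s, (P s * (if residual e s k ∉ T k then 1 else 0)) +
                (∑ s, P s) * (M * ((T k).card / 2 ^ n))) := by
                rw [Finset.sum_mul, ← Finset.sum_add_distrib, Finset.mul_sum]
                exact Finset.sum_congr rfl fun s _ => by ring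
            _ = _ := by
                rw [hP1, one_mul]
                simp only [mul_ite, mul_one, mul_zero]
      _ = _ := by rw [Finset.sum_const, Finset.card_univ, nsmul_eq_mul]
  obtain ⟨b, -, hb⟩ := Finset.exists_le_of_sum_le Finset.univ_nonempty hsum
  exact ⟨b, hb⟩

/-- The sequences that are not too unlikely under a product law. -/
def likelySet {n : ℕ} (μ : Fin n → PMF (ZMod 2)) (δ : ℝ) : Finset (Fin n → ZMod 2) :=
  open Classical in Finset.univ.filter fun z =>
    Real.exp (-(∑ i, natEntropy (μ i) + n * δ)) ≤ ∏ i, (μ i (z i)).toReal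

/-- Each member has at least the threshold probability, and the total is at most 1. -/
theorem card_likelySet_le {n : ℕ} (μ : Fin n → PMF (ZMod 2)) (δ : ℝ) :
    ((likelySet μ δ).card : ℝ) ≤ Real.exp (∑ i, natEntropy (μ i) + n * δ) := by
  have h : (likelySet μ δ).card * Real.exp (-(∑ i, natEntropy (μ i) + n * δ)) ≤ 1 := by
    rw [← sum_prod_toReal μ, ← nsmul_eq_mul, ← Finset.sum_const]
    calc _ ≤ ∑ z ∈ likelySet μ δ, ∏ i, (μ i (z i)).toReal :=
          Finset.sum_le_sum fun z hz => (Finset.mem_filter.1 hz).2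
      _ ≤ _ := Finset.sum_le_sum_of_subset_of_nonneg (Finset.subset_univ _) fun s _ _ =>
          Finset.prod_nonneg fun _ _ => ENNReal.toReal_nonneg
  rwa [Real.exp_neg, ← div_eq_mul_inv, div_le_one (Real.exp_pos _)] at h

theorem sum_notMem_likelySet_le {α : Type*} [Fintype α] {n : ℕ} (p : PMF α)
    (g : Fin n → α → ZMod 2) {B δ : ℝ} (hδ : 0 < δ) (hB : δ ≤ B)
    (hX : ∀ i b, |logDev (p.map (g i)) b| ≤ B) :
    (∑ s : Fin n → α, if (fun i => g i (s i)) ∉ likelySet (fun i => p.map (g i)) δ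
      then ∏ i, (p (s i)).toReal else 0) ≤ Real.exp (-(n * (δ ^ 2 / (4 * B ^ 2)))) := by
  have htail := chernoff (ι := Fin n) p (fun i a => -logDev (p.map (g i)) (g i a)) hδ hB
    (fun i a => by rw [abs_neg]; exact hX i (g i a))
    (fun i => by
      simp only [mul_neg, Finset.sum_neg_distrib]
      rw [← sum_toReal_map_mul p (g i) (logDev (p.map (g i))), sum_mul_logDev, neg_zero])
  rw [Fintype.card_fin] at htail
  refine le_trans (Finset.sum_le_sum fun s _ => ?_) htail
  have hP0 : 0 ≤ ∏ i, (p (s i)).toReal := Finset.prod_nonneg fun _ _ => ENNReal.toReal_nonneg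
  have hnn : (0 : ℝ) ≤ if n * δ ≤ ∑ i, -logDev (p.map (g i)) (g i (s i))
      then ∏ i, (p (s i)).toReal else 0 := by
    split_ifs
    exacts [hP0, le_rfl]
  by_cases h1 : (fun i => g i (s i)) ∈ likelySet (fun i => p.map (g i)) δ
  · rw [if_neg (not_not.2 h1)]
    exact hnn
  rw [if_pos h1]
  by_cases h0 : ∀ i, (p.map (g i) (g i (s i))).toReal ≠ 0
  · rw [if_pos]
    by_contra h2
    apply h1
    simp only [likelySet, Finset.mem_filter, Finset.mem_univ, true_and]
    rw [prod_toReal_eq_exp (fun i => p.map (g i)) _ h0]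
    refine Real.exp_le_exp.2 ?_
    rw [Finset.sum_neg_distrib] at h2
    linarith
  · push Not at h0
    obtain ⟨i, hi⟩ := h0
    have hi0 : (p (s i)).toReal = 0 :=
      le_antisymm ((toReal_le_toReal_map p (g i) (s i)).trans_eq hi) ENNReal.toReal_nonneg
    exact (Finset.prod_eq_zero (Finset.mem_univ i) hi0).trans_le hnn

theorem Code.errorProb_nonneg {K n M : ℕ} (c : Code K n M) (p : PMF (Fin K → ZMod 2)) :
    0 ≤ c.errorProb p := by
  refine div_nonneg (Finset.sum_nonneg fun w _ => Finset.sum_nonneg fun s _ => ?_)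
    (Nat.cast_nonneg _)
  split_ifs
  exacts [Finset.prod_nonneg fun _ _ => ENNReal.toReal_nonneg, le_rfl]

theorem numMessages_le {R : ℝ} (hR : 0 ≤ R) (n : ℕ) :
    (numMessages R n : ℝ) ≤ 2 * Real.exp (n * R * Real.log 2) := by
  have h1 := (Nat.ceil_lt_add_one (Real.rpow_nonneg zero_le_two ((n : ℝ) * R))).le
  have h2 : (1 : ℝ) ≤ 2 ^ ((n : ℝ) * R) := Real.one_le_rpow one_le_two (by positivity)
  rw [← two_rpow_eq_exp]
  exact h1.trans (by linarith)

/-- Achievability by random coding, in terms of the entropies of the residual noise. -/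
theorem exists_codes {K : ℕ} (p : PMF (Fin K → ZMod 2)) (e : ℕ → (Fin K → ZMod 2) → ZMod 2)
    {R h C : ℝ} (hR : 0 ≤ R) (hlt : R * Real.log 2 < Real.log 2 - h)
    (hH : ∀ (n : ℕ) (k : Fin K),
      ∑ i : Fin n, natEntropy (p.map fun s => e i s + s k) ≤ n * h + C) :
    ∃ (δ : ℝ) (w₀ : ∀ n, Fin (numMessages R n))
      (b : ∀ n, Fin (numMessages R n) → Fin n → ZMod 2),
      Tendsto (fun n => (thresholdCode (fun i : Fin n => e i)
        (fun k => likelySet (fun i : Fin n => p.map fun s => e i s + s k) δ)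
        (w₀ n) (b n)).errorProb p) atTop (𝓝 0) := by
  set γ := Real.log 2 - h - R * Real.log 2 with hγ
  have hγ0 : 0 < γ := by linarith
  -- Half of the rate gap γ pays for the size of the likely set; the other half makes the
  -- wrong-codeword term decay like exp(-nδ).
  set δ := γ / 2 with hδ
  have hδ0 : 0 < δ := by positivity
  -- There are finitely many maps from interference tuples to bits, so one bound serves all slots,
  -- receivers and block lengths.
  obtain ⟨B₀, hB₀⟩ := Finite.exists_le
    fun x : ((Fin K → ZMod 2) → ZMod 2) × ZMod 2 => |logDev (p.map x.1) x.2|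
  set B := max δ B₀ with hBdef
  have hB : δ ≤ B := le_max_left _ _
  have hB0 : 0 < B := hδ0.trans_le hB
  set w₀ : ∀ n, Fin (numMessages R n) := fun n => ⟨0, numMessages_pos R n⟩ with hw₀
  choose b hb using fun n => exists_codebook p (fun i : Fin n => e i)
    (fun k => likelySet (fun i : Fin n => p.map fun s => e i s + s k) δ) (w₀ n)
  refine ⟨δ, w₀, b, squeeze_zero (fun n => Code.errorProb_nonneg _ p)
    (g := fun n : ℕ => K * (Real.exp (-(n * (δ ^ 2 / (4 * B ^ 2)))) +
      2 * Real.exp C * Real.exp (-(n * δ)))) (fun n => (hb n).trans ?_) ?_⟩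
  · rw [← nsmul_eq_mul]
    conv_rhs => rw [← Fintype.card_fin K, ← Finset.card_univ, ← Finset.sum_const]
    refine Finset.sum_le_sum fun k _ => add_le_add ?_ ?_
    · exact sum_notMem_likelySet_le p (fun (i : Fin n) s => e i s + s k) hδ0 hB
        fun i x => (hB₀ (fun s => e i s + s k, x)).trans (le_max_right _ _)
    · rw [mul_div_assoc', div_le_iff₀ (by positivity), ← Real.rpow_natCast, two_rpow_eq_exp]
      have h1 := (card_likelySet_le (fun i : Fin n => p.map fun s => e i s + s k) δ).trans
        (Real.exp_le_exp.2 (add_le_add (hH n k) (le_refl (n * δ))))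
      refine (mul_le_mul (numMessages_le hR n) h1 (Nat.cast_nonneg _) (by positivity)).trans
        (le_of_eq ?_)
      simp only [mul_assoc, ← Real.exp_add]
      congr 2
      rw [hδ, hγ]
      ring
  · have h1 := tendsto_exp_neg_nat_mul (c := δ ^ 2 / (4 * B ^ 2)) (by positivity)
    have h2 := (tendsto_exp_neg_nat_mul hδ0).const_mul (2 * Real.exp C)
    simpa using (h1.add h2).const_mul (K : ℝ)

/-! ### Interference as noise, and precancellation in turn -/

theorem log_two_mul_lt {R H : ℝ} (h : R < 1 - H) :
    R * Real.log 2 < Real.log 2 - H * Real.log 2 := by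
  have := mul_lt_mul_of_pos_right h (Real.log_pos (by norm_num : (1 : ℝ) < 2))
  linarith

/-- Treating the interference as noise. -/
theorem mem_achievableRates_of_lt {K : ℕ} {p : PMF (Fin K → ZMod 2)} {r : PMF (ZMod 2)}
    (hr : ∀ k, p.map (fun s => s k) = r) {R : ℝ} (hR : 0 ≤ R) (hlt : R < 1 - entropy r) :
    R ∈ achievableRates p := by
  obtain ⟨δ, w₀, b, h⟩ := exists_codes p (fun _ _ => 0) (C := 0) hR (log_two_mul_lt hlt)
    (fun n k => by simp only [zero_add, hr, natEntropy_eq]; simp)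
  exact ⟨hR, _, h⟩

/-- Slots assigned cyclically to the receivers. -/
def slot {K : ℕ} (hK : 0 < K) (i : ℕ) : Fin K := ⟨i % K, Nat.mod_lt i hK⟩

theorem le_count_slot {K : ℕ} (hK : 0 < K) (n : ℕ) (k : Fin K) :
    (n : ℝ) / K - 1 ≤ (Finset.univ.filter fun i : Fin n => slot hK i = k).card := by
  have h1 : (Finset.univ.filter fun i : Fin n => slot hK i = k).card =
      Nat.count (fun x => x ≡ k [MOD K]) n := by
    rw [Nat.count_eq_card_filter_range, Finset.card_filter, Finset.card_filter,
      ← Fin.sum_univ_eq_sum_range (fun i => if i ≡ k [MOD K] then 1 else 0)]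
    refine Finset.sum_congr rfl fun i _ => ?_
    simp [slot, Fin.ext_iff, Nat.ModEq, Nat.mod_eq_of_lt k.2]
  have h2 : n / K ≤ Nat.count (fun x => x ≡ k [MOD K]) n := by
    rw [Nat.count_modEq_card n hK]
    exact Nat.le_add_right _ _
  rw [h1]
  have h3 : ((n / K : ℕ) : ℝ) ≤ Nat.count (fun x => x ≡ k [MOD K]) n := by exact_mod_cast h2
  refine le_trans ?_ h3
  rw [sub_le_iff_le_add, div_le_iff₀ (by exact_mod_cast hK)]
  have h4 := Nat.lt_div_mul_add (a := n) hK
  have h5 : (n : ℝ) < (n / K : ℕ) * K + K := by exact_mod_cast h4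
  linarith

theorem natEntropy_map_const {α β : Type*} [Fintype β] (p : PMF α) (b : β) :
    natEntropy (p.map fun _ => b) = 0 := by
  classical
  have : p.map (fun _ => b) = PMF.pure b := PMF.map_const p b
  rw [this, natEntropy]
  refine Finset.sum_eq_zero fun a _ => ?_
  by_cases h : a = b <;> simp [PMF.pure_apply, h]

/-- Precancelling the interference of the receivers in turn. -/
theorem exists_turn_codes {K : ℕ} (hK : 0 < K) {p : PMF (Fin K → ZMod 2)} {r : PMF (ZMod 2)}
    (hr : ∀ k k', k ≠ k' → p.map (fun s => s k + s k') = r) {R : ℝ} (hR : 0 ≤ R)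
    (hlt : R < 1 - (1 - 1 / (K : ℝ)) * entropy r) :
    ∃ (δ : ℝ) (w₀ : ∀ n, Fin (numMessages R n))
      (b : ∀ n, Fin (numMessages R n) → Fin n → ZMod 2),
      Tendsto (fun n => (thresholdCode (fun (i : Fin n) s => s (slot hK i))
        (fun k => likelySet (fun i : Fin n => p.map fun s => s (slot hK i) + s k) δ)
        (w₀ n) (b n)).errorProb p) atTop (𝓝 0) := by
  -- When K does not divide n, a receiver may fall short of n/K slots by less than one; the constant
  -- `C` absorbs this.
  refine exists_codes p (fun i s => s (slot hK i)) (C := natEntropy r) hR (log_two_mul_lt hlt)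
    fun n k => ?_
  have hi : ∀ i : Fin n, natEntropy (p.map fun s => s (slot hK i) + s k) =
      natEntropy r - if slot hK i = k then natEntropy r else 0 := by
    intro i
    split_ifs with h
    · simp only [h, CharTwo.add_self_eq_zero, natEntropy_map_const, sub_self]
    · rw [hr _ _ h, sub_zero]
  simp_rw [hi]
  rw [Finset.sum_sub_distrib, Finset.sum_const, ← Finset.sum_filter, Finset.sum_const,
    Finset.card_univ, Fintype.card_fin, nsmul_eq_mul, nsmul_eq_mul]
  have h1 := mul_le_mul_of_nonneg_right (le_count_slot hK n k) (natEntropy_nonneg r)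
  rw [mul_assoc (1 - 1 / (K : ℝ)), ← natEntropy_eq]
  have h2 : ((n : ℝ) / K - 1) * natEntropy r = n * (1 / K * natEntropy r) - natEntropy r := by
    ring
  linarith

theorem mem_achievableRates_of_lt_turn {K : ℕ} (hK : 0 < K) {p : PMF (Fin K → ZMod 2)}
    {r : PMF (ZMod 2)} (hr : ∀ k k', k ≠ k' → p.map (fun s => s k + s k') = r) {R : ℝ}
    (hR : 0 ≤ R) (hlt : R < 1 - (1 - 1 / (K : ℝ)) * entropy r) : R ∈ achievableRates p := by
  obtain ⟨δ, w₀, b, h⟩ := exists_turn_codes hK hr hR hlt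
  exact ⟨hR, _, h⟩

/-- If the sums of two interference bits are uniform, then precancelling in turn amounts to
time-sharing. -/
theorem mem_timeSharingRates_of_lt {K : ℕ} (hK : 0 < K) {p : PMF (Fin K → ZMod 2)}
    {r : PMF (ZMod 2)} (hr : ∀ k k', k ≠ k' → p.map (fun s => s k + s k') = r)
    (hu : ∀ x y, r x = r y) {R : ℝ}
    (hR : 0 ≤ R) (hlt : R < 1 - (1 - 1 / (K : ℝ)) * entropy r) : R ∈ timeSharingRates p := by
  obtain ⟨δ, w₀, b, h⟩ := exists_turn_codes hK hr hR hlt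
  refine ⟨hR, _, fun n => ⟨fun i => slot hK i, b n, fun w s i => rfl, ?_⟩, h⟩
  intro k y y' hy
  set T := likelySet (fun i : Fin n => p.map fun s => s (slot hK i) + s k) δ with hT
  -- Outside the receiver's own slots the likelihood factor is constant, so the test does not see
  -- those outputs.
  have hmem : (fun w => y - b n w ∈ T) = fun w => y' - b n w ∈ T := by
    funext w
    simp only [hT, likelySet, Finset.mem_filter, Finset.mem_univ, true_and]
    refine congrArg _ (Finset.prod_congr rfl fun i _ => congrArg _ ?_)
    by_cases hi : slot hK i = k
    · rw [Pi.sub_apply, Pi.sub_apply, hy i hi]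
    · rw [hr _ _ hi]
      exact hu _ _
  exact congrArg (pick (w₀ n)) hmem

/-! ### Bounds on the capacity -/

theorem zero_mem_achievableRates {K : ℕ} (p : PMF (Fin K → ZMod 2)) : 0 ∈ achievableRates p := by
  have h1 : ∀ n, numMessages 0 n = 1 := fun n => by simp [numMessages]
  have hs : ∀ n, Subsingleton (Fin (numMessages 0 n)) := fun n => by
    rw [h1]; infer_instance
  refine ⟨le_rfl, fun n => ⟨fun _ _ _ => 0, fun _ _ => ⟨0, numMessages_pos 0 n⟩⟩, ?_⟩
  refine tendsto_const_nhds.congr fun n => ?_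
  rw [Code.errorProb, eq_comm, div_eq_zero_iff]
  left
  refine Finset.sum_eq_zero fun w _ => Finset.sum_eq_zero fun s _ => if_neg ?_
  rintro ⟨k, hk⟩
  exact hk (Subsingleton.elim _ _)

theorem bddAbove_achievableRates {K : ℕ} (hK : 0 < K) (p : PMF (Fin K → ZMod 2)) :
    BddAbove (achievableRates p) :=
  ⟨_, fun _ hR => le_of_mem_achievableRates ⟨0, hK⟩ hR⟩

theorem isLUB_capacity {K : ℕ} (hK : 0 < K) (p : PMF (Fin K → ZMod 2)) :
    IsLUB (achievableRates p) (capacity p) :=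
  isLUB_csSup ⟨0, zero_mem_achievableRates p⟩ (bddAbove_achievableRates hK p)

theorem capacity_le {K : ℕ} (k₀ : Fin K) (p : PMF (Fin K → ZMod 2)) :
    capacity p ≤
      1 - 1 / (K : ℝ) * entropy (p.map fun s (k : {k // k ≠ k₀}) => s k₀ + s k) :=
  (isLUB_capacity k₀.pos p).2 fun _ hR => le_of_mem_achievableRates k₀ hR

/-- Only nonnegative rates are available, so `hc0` covers the case of a negative x. -/
theorem le_of_isLUB_of_lt {S : Set ℝ} {c x : ℝ} (hc : IsLUB S c) (hc0 : 0 ≤ c)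
    (h : ∀ R, 0 ≤ R → R < x → R ∈ S) : x ≤ c := by
  refine le_of_forall_lt fun R hR => ?_
  obtain ⟨y, hy1, hy2⟩ := exists_between hR
  rcases lt_or_ge y 0 with hy | hy
  · linarith
  · exact hy1.trans_le (hc.1 (h y hy hy2))

theorem capacity_nonneg {K : ℕ} (hK : 0 < K) (p : PMF (Fin K → ZMod 2)) : 0 ≤ capacity p :=
  (isLUB_capacity hK p).1 (zero_mem_achievableRates p)

theorem le_capacity {K : ℕ} (hK : 0 < K) {p : PMF (Fin K → ZMod 2)} {r r' : PMF (ZMod 2)}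
    (hr : ∀ k, p.map (fun s => s k) = r)
    (hr' : ∀ k k', k ≠ k' → p.map (fun s => s k + s k') = r') :
    max (1 - entropy r) (1 - (1 - 1 / (K : ℝ)) * entropy r') ≤ capacity p :=
  max_le
    (le_of_isLUB_of_lt (isLUB_capacity hK p) (capacity_nonneg hK p)
      fun _ h0 h => mem_achievableRates_of_lt hr h0 h)
    (le_of_isLUB_of_lt (isLUB_capacity hK p) (capacity_nonneg hK p)
      fun _ h0 h => mem_achievableRates_of_lt_turn hK hr' h0 h)

/-! ### Symmetric and i.i.d. interference -/

theorem IsSymmetric.map_eval {K : ℕ} {p : PMF (Fin K → ZMod 2)} (hp : IsSymmetric p)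
    (k k' : Fin K) : p.map (fun s => s k) = p.map (fun s => s k') := by
  have h := hp 1 (fun _ => k) (fun _ => k') (Function.injective_of_subsingleton _)
    (Function.injective_of_subsingleton _)
  have h2 := congrArg (PMF.map fun t : Fin 1 → ZMod 2 => t 0) h
  rwa [PMF.map_comp, PMF.map_comp] at h2

theorem IsSymmetric.map_add {K : ℕ} {p : PMF (Fin K → ZMod 2)} (hp : IsSymmetric p)
    {k l k' l' : Fin K} (hkl : k ≠ l) (hkl' : k' ≠ l') :
    p.map (fun s => s k + s l) = p.map (fun s => s k' + s l') := by
  have hinj : ∀ {a b : Fin K}, a ≠ b → Function.Injective ![a, b] := by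
    intro a b hab i j hij
    fin_cases i <;> fin_cases j <;> simp_all
  have h := hp 2 ![k, l] ![k', l'] (hinj hkl) (hinj hkl')
  have h2 := congrArg (PMF.map fun t : Fin 2 → ZMod 2 => t 0 + t 1) h
  rwa [PMF.map_comp, PMF.map_comp] at h2

theorem iidLaw_apply {K : ℕ} (q : PMF (ZMod 2)) (s : Fin K → ZMod 2) :
    iidLaw K q s = ∏ k, q (s k) := rfl

theorem toReal_iidLaw {K : ℕ} (q : PMF (ZMod 2)) (s : Fin K → ZMod 2) :
    (iidLaw K q s).toReal = ∏ k, (q (s k)).toReal := by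
  rw [iidLaw_apply, ENNReal.toReal_prod]

theorem pmf_ext_toReal {α : Type*} {p p' : PMF α} (h : ∀ a, (p a).toReal = (p' a).toReal) :
    p = p' :=
  PMF.ext fun a => (ENNReal.toReal_eq_toReal_iff' (p.apply_ne_top a) (p'.apply_ne_top a)).1 (h a)

theorem iidLaw_map_perm {K : ℕ} (q : PMF (ZMod 2)) (σ : Equiv.Perm (Fin K)) :
    (iidLaw K q).map (fun s j => s (σ j)) = iidLaw K q := by
  refine pmf_ext_toReal fun t => ?_
  rw [toReal_map, Finset.sum_eq_single (fun j => t (σ.symm j))]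
  · simp only [Equiv.symm_apply_apply, if_true, toReal_iidLaw]
    exact Equiv.prod_comp σ.symm fun j => (q (t j)).toReal
  · intro s _ hs
    refine if_neg fun h => hs ?_
    funext j
    simp [← h]
  · simp

/-- Some permutation carries one injective index tuple to the other, and the product law is
invariant under permutations. -/
theorem isSymmetric_iidLaw (K : ℕ) (q : PMF (ZMod 2)) : IsSymmetric (iidLaw K q) := by
  intro m k k' hk hk'
  have := Equiv.Perm.isMultiplyPretransitive (Fin K) m
  obtain ⟨σ, hσ⟩ := MulAction.exists_smul_eq (Equiv.Perm (Fin K))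
    (⟨k, hk⟩ : Fin m ↪ Fin K) ⟨k', hk'⟩
  have hσ' : ∀ j, σ (k j) = k' j := fun j => DFunLike.congr_fun hσ j
  have h := congrArg (PMF.map fun (s : Fin K → ZMod 2) j => s (k j)) (iidLaw_map_perm q σ)
  rw [PMF.map_comp] at h
  rw [← h]
  congr 1
  funext s j
  simp [hσ']

/-! ### Entropy of the differences and the limit of many receivers -/

theorem sum_fun_split {ι A : Type*} [Fintype ι] [DecidableEq ι] [Fintype A] (i : ι)
    (Φ : (ι → A) → ℝ) :
    ∑ s, Φ s = ∑ a, ∑ d : {j // j ≠ i} → A, Φ ((Equiv.funSplitAt i A).symm (a, d)) := by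
  rw [← Fintype.sum_prod_type', Equiv.sum_comp]

theorem prod_funSplitAt_symm {ι A : Type*} [Fintype ι] [DecidableEq ι] (i : ι) (f : A → ℝ)
    (a : A) (d : {j // j ≠ i} → A) :
    ∏ j, f ((Equiv.funSplitAt i A).symm (a, d) j) = f a * ∏ j, f (d j) := by
  rw [Fintype.prod_eq_mul_prod_subtype_ne _ i]
  congr 1
  · simp [Equiv.funSplitAt, Equiv.piSplitAt]
  · refine Finset.prod_congr rfl fun j _ => ?_
    simp [Equiv.funSplitAt, Equiv.piSplitAt, j.2]

theorem sum_prod_mul_eval {ι A : Type*} [Fintype ι] [DecidableEq ι] [Fintype A] (q : PMF A)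
    (i : ι) (F : A → ℝ) :
    ∑ d : ι → A, (∏ j, (q (d j)).toReal) * F (d i) = ∑ a, (q a).toReal * F a := by
  rw [sum_fun_split i]
  refine Finset.sum_congr rfl fun a _ => ?_
  simp_rw [prod_funSplitAt_symm i (fun a => (q a).toReal) a]
  have h : ∀ d : {j // j ≠ i} → A, (Equiv.funSplitAt i A).symm (a, d) i = a := by
    intro d
    simp [Equiv.funSplitAt, Equiv.piSplitAt]
  simp_rw [h, ← Finset.sum_mul, ← Finset.mul_sum, sum_prod_toReal (fun _ => q), mul_one]

theorem iidLaw_map_eval {K : ℕ} (q : PMF (ZMod 2)) (k : Fin K) :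
    (iidLaw K q).map (fun s => s k) = q := by
  refine pmf_ext_toReal fun x => ?_
  rw [toReal_map]
  have h := sum_prod_mul_eval q k fun a => if a = x then 1 else 0
  simpa [toReal_iidLaw] using h

/-- The entropy of independent identically distributed symbols. -/
theorem sum_negMulLog_prod {ι A : Type*} [Fintype ι] [DecidableEq ι] [Fintype A] (q : PMF A) :
    ∑ d : ι → A, Real.negMulLog (∏ j, (q (d j)).toReal) = Fintype.card ι * natEntropy q := by
  have h : ∀ d : ι → A, Real.negMulLog (∏ j, (q (d j)).toReal) =
      ∑ i, (∏ j, (q (d j)).toReal) * -Real.log (q (d i)).toReal := by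
    intro d
    by_cases h0 : ∀ j ∈ Finset.univ, (q (d j)).toReal ≠ 0
    · rw [Real.negMulLog, Real.log_prod h0, Finset.mul_sum]
      exact Finset.sum_congr rfl fun i _ => by ring
    · push Not at h0
      obtain ⟨j, hj, hj0⟩ := h0
      have hprod : ∏ j, (q (d j)).toReal = 0 := Finset.prod_eq_zero hj hj0
      simp [hprod]
  simp_rw [h]
  rw [Finset.sum_comm]
  simp_rw [sum_prod_mul_eval q _ fun a => -Real.log (q a).toReal]
  rw [Finset.sum_const, Finset.card_univ, nsmul_eq_mul, natEntropy]
  congr 1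
  exact Finset.sum_congr rfl fun a _ => by rw [Real.negMulLog]; ring

/-- The law of the differences from one of several independent bits. -/
theorem toReal_map_diff_iidLaw {K : ℕ} (q : PMF (ZMod 2)) (k₀ : Fin K)
    (d : {k // k ≠ k₀} → ZMod 2) :
    ((iidLaw K q).map (fun s (k : {k // k ≠ k₀}) => s k₀ + s k) d).toReal =
      ∑ x, (q x).toReal * ∏ k, (q (x + d k)).toReal := by
  rw [toReal_map, sum_fun_split k₀]
  refine Finset.sum_congr rfl fun x _ => ?_
  have hx : ∀ d', (fun k : {k // k ≠ k₀} => (Equiv.funSplitAt k₀ (ZMod 2)).symm (x, d') k₀ +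
      (Equiv.funSplitAt k₀ (ZMod 2)).symm (x, d') k) = fun k => x + d' k := by
    intro d'
    funext k
    simp [Equiv.funSplitAt, Equiv.piSplitAt, k.2]
  simp_rw [hx, toReal_iidLaw, prod_funSplitAt_symm k₀ (fun a => (q a).toReal) x]
  rw [Finset.sum_eq_single (fun k => x + d k)]
  · simp [← add_assoc, CharTwo.add_self_eq_zero]
  · intro d' _ hd'
    refine if_neg fun h => hd' ?_
    rw [← h]
    funext k
    rw [← add_assoc, CharTwo.add_self_eq_zero, zero_add]
  · simp

theorem card_ne {K : ℕ} (k₀ : Fin K) : Fintype.card {k // k ≠ k₀} = K - 1 := by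
  simp

/-- Conditioning reduces entropy: the differences have at least the entropy of `K - 1`
independent bits. -/
theorem le_natEntropy_map_diff_iidLaw {K : ℕ} (q : PMF (ZMod 2)) (k₀ : Fin K) :
    ((K : ℝ) - 1) * natEntropy q ≤
      natEntropy ((iidLaw K q).map (fun s (k : {k // k ≠ k₀}) => s k₀ + s k)) := by
  calc ((K : ℝ) - 1) * natEntropy q
      = ∑ x, (q x).toReal * ∑ d : {k // k ≠ k₀} → ZMod 2,
          Real.negMulLog (∏ k, (q (x + d k)).toReal) := by
        have h : ∀ x : ZMod 2, ∑ d : {k // k ≠ k₀} → ZMod 2,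
            Real.negMulLog (∏ k, (q (x + d k)).toReal) = ((K : ℝ) - 1) * natEntropy q := by
          intro x
          have hcard : (K : ℝ) - 1 = Fintype.card {k // k ≠ k₀} := by
            rw [card_ne, Nat.cast_sub k₀.pos, Nat.cast_one]
          rw [hcard, ← sum_negMulLog_prod]
          -- Given the reference bit x, the differences are a translate of the K-1 remaining
          -- independent bits.
          exact Equiv.sum_comp (Equiv.addLeft fun _ : {k // k ≠ k₀} => x)
            fun d => Real.negMulLog (∏ k, (q (d k)).toReal)
        simp_rw [h]
        rw [← Finset.sum_mul, sum_toReal, one_mul]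
    _ = ∑ d : {k // k ≠ k₀} → ZMod 2, ∑ x, (q x).toReal *
          Real.negMulLog (∏ k, (q (x + d k)).toReal) := by
        simp_rw [Finset.mul_sum]
        rw [Finset.sum_comm]
    _ ≤ _ := by
        refine Finset.sum_le_sum fun d _ => ?_
        rw [toReal_map_diff_iidLaw]
        -- Jensen's inequality for the mixture over the reference bit.
        exact Real.concaveOn_negMulLog.le_map_sum (fun _ _ => ENNReal.toReal_nonneg)
          (sum_toReal q) fun x _ => Finset.prod_nonneg fun _ _ => ENNReal.toReal_nonneg

/-- With many receivers and independent interferences, the capacity is asymptotically that of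
the channel with interference unknown to the encoder. -/
theorem tendsto_capacity_iidLaw (q : PMF (ZMod 2)) :
    Tendsto (fun K : ℕ => capacity (iidLaw K q)) atTop (𝓝 (1 - entropy q)) := by
  have hl : 0 < Real.log 2 := Real.log_pos (by norm_num)
  have h1 : Tendsto (fun K : ℕ => 1 - entropy q + entropy q * (1 / (K : ℝ))) atTop
      (𝓝 (1 - entropy q + entropy q * 0)) :=
    tendsto_const_nhds.add (tendsto_one_div_atTop_nhds_zero_nat.const_mul _)
  rw [mul_zero, add_zero] at h1
  refine tendsto_of_tendsto_of_tendsto_of_le_of_le' tendsto_const_nhds h1 ?_ ?_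
  · filter_upwards [eventually_ge_atTop 1] with K hK
    exact le_of_isLUB_of_lt (isLUB_capacity hK _) (capacity_nonneg hK _)
      fun _ h0 h => mem_achievableRates_of_lt (iidLaw_map_eval q) h0 h
  · filter_upwards [eventually_ge_atTop 1] with K hK
    have hK' : (0 : ℝ) < K := by exact_mod_cast hK
    refine (capacity_le ⟨0, hK⟩ _).trans ?_
    have h2 := le_natEntropy_map_diff_iidLaw q (⟨0, hK⟩ : Fin K)
    rw [natEntropy_eq, natEntropy_eq, ← mul_assoc] at h2
    have h3 := mul_le_mul_of_nonneg_left (le_of_mul_le_mul_right h2 hl)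
      (by positivity : 0 ≤ 1 / (K : ℝ))
    have h4 : 1 / (K : ℝ) * ((K - 1) * entropy q) = entropy q - entropy q * (1 / K) := by
      field_simp
    linarith

/-! ### Fair bits and time-sharing -/

/-- A bit that is one with probability one half is uniform. -/
theorem toReal_of_apply_one {q : PMF (ZMod 2)} (hq : q 1 = 1 / 2) (x : ZMod 2) :
    (q x).toReal = 1 / 2 := by
  have h1 : (q 1).toReal = 1 / 2 := by simp [hq]
  have h := sum_toReal q
  have h2 : ∑ a, (q a).toReal = (q 0).toReal + (q 1).toReal := Fin.sum_univ_two _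
  fin_cases x
  · change (q 0).toReal = _
    linarith
  · exact h1

theorem natEntropy_of_uniform {α : Type*} [Fintype α] [Nonempty α] (p : PMF α)
    (h : ∀ a, (p a).toReal = (Fintype.card α : ℝ)⁻¹) :
    natEntropy p = Real.log (Fintype.card α) := by
  simp_rw [natEntropy, h, Finset.sum_const, Finset.card_univ, nsmul_eq_mul, Real.negMulLog,
    Real.log_inv]
  have : (Fintype.card α : ℝ) ≠ 0 := by exact_mod_cast Fintype.card_ne_zero
  field_simp

theorem toReal_map_add_of_uniform {K : ℕ} {q : PMF (ZMod 2)} (hq : q 1 = 1 / 2) {k k' : Fin K}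
    (hk : k ≠ k') (x : ZMod 2) :
    ((iidLaw K q).map (fun s => s k + s k') x).toReal = 1 / 2 := by
  have hu := toReal_of_apply_one hq
  have h : (iidLaw K q).map (fun s => s k + s k') =
      ((iidLaw K q).map (fun s (j : {j // j ≠ k}) => s k + s j)).map
        (fun d => d ⟨k', hk.symm⟩) := by
    rw [PMF.map_comp]
    rfl
  rw [h, toReal_map]
  simp_rw [toReal_map_diff_iidLaw, hu]
  have h2 := sum_prod_mul_eval q (⟨k', hk.symm⟩ : {j // j ≠ k}) fun a => if a = x then 1 else 0
  simp_rw [hu] at h2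
  have h3 : ∑ _x : ZMod 2, (1 / 2 : ℝ) * ∏ _j : {j // j ≠ k}, (1 / 2 : ℝ) =
      ∏ _j : {j // j ≠ k}, (1 / 2 : ℝ) := by
    rw [Finset.sum_const, Finset.card_univ, ZMod.card, nsmul_eq_mul]
    push_cast
    ring
  rw [h3]
  simpa using h2

theorem entropy_of_uniform {q : PMF (ZMod 2)} (hq : q 1 = 1 / 2) : entropy q = 1 := by
  have hl : 0 < Real.log 2 := Real.log_pos (by norm_num)
  have h := natEntropy_of_uniform q fun a => by rw [toReal_of_apply_one hq, ZMod.card]; norm_num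
  rw [natEntropy_eq, ZMod.card] at h
  exact mul_right_cancel₀ hl.ne' (h.trans (by push_cast; ring))

theorem mem_timeSharingRates_of_uniform {K : ℕ} (hK : 0 < K) {q : PMF (ZMod 2)}
    (hq : q 1 = 1 / 2) {R : ℝ} (hR : 0 ≤ R) (hlt : R < 1 / (K : ℝ)) :
    R ∈ timeSharingRates (iidLaw K q) := by
  refine mem_timeSharingRates_of_lt hK (r := q) (fun k k' hk => pmf_ext_toReal fun x => ?_)
    (fun x y => ?_) hR ?_
  · rw [toReal_map_add_of_uniform hq hk, toReal_of_apply_one hq]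
  · exact (ENNReal.toReal_eq_toReal_iff' (q.apply_ne_top x) (q.apply_ne_top y)).1
      (by rw [toReal_of_apply_one hq, toReal_of_apply_one hq])
  · rw [entropy_of_uniform hq]
    linarith

theorem timeSharingRates_subset {K : ℕ} (p : PMF (Fin K → ZMod 2)) :
    timeSharingRates p ⊆ achievableRates p :=
  fun _ ⟨h, c, _, hc⟩ => ⟨h, c, hc⟩

theorem le_inv_of_mem_achievableRates_uniform {K : ℕ} (hK : 0 < K) {q : PMF (ZMod 2)}
    (hq : q 1 = 1 / 2) {R : ℝ} (hR : R ∈ achievableRates (iidLaw K q)) : R ≤ 1 / (K : ℝ) := by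
  have hl : 0 < Real.log 2 := Real.log_pos (by norm_num)
  have hK' : (0 : ℝ) < K := by exact_mod_cast hK
  have h := le_of_mem_achievableRates ⟨0, hK⟩ hR
  have h2 := le_natEntropy_map_diff_iidLaw q (⟨0, hK⟩ : Fin K)
  rw [natEntropy_eq, natEntropy_eq, ← mul_assoc, entropy_of_uniform hq, mul_one] at h2
  have h3 := mul_le_mul_of_nonneg_left (le_of_mul_le_mul_right h2 hl)
    (by positivity : 0 ≤ 1 / (K : ℝ))
  have h4 : 1 / (K : ℝ) * (K - 1) = 1 - 1 / K := by
    field_simp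
  linarith

theorem isLUB_of_lt_of_le {S : Set ℝ} {x : ℝ} (hx : 0 < x) (hle : ∀ R ∈ S, R ≤ x)
    (h : ∀ R, 0 ≤ R → R < x → R ∈ S) : IsLUB S x := by
  refine ⟨hle, fun c hc => ?_⟩
  refine le_of_forall_lt fun R hR => ?_
  -- The maximum with 0 keeps y an admissible rate.
  obtain ⟨y, hy1, hy2⟩ := exists_between (max_lt hR hx)
  exact ((le_max_left _ _).trans_lt hy1).trans_le
    (hc (h y ((le_max_right _ _).trans hy1.le) hy2))

end BinaryMulticast

end

theorem theorem2 :
    -- the bounds on the capacity, for i.i.d. or, more generally, symmetric interferences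
    (∀ (K : ℕ) (hK : 2 ≤ K) (p : PMF (Fin K → ZMod 2)),
      ((∃ q : PMF (ZMod 2), p = BinaryMulticast.iidLaw K q) ∨ BinaryMulticast.IsSymmetric p) →
      IsLUB (BinaryMulticast.achievableRates p) (BinaryMulticast.capacity p) ∧
      max (1 - BinaryMulticast.entropy (p.map fun s => s ⟨0, by omega⟩))
          (1 - (1 - 1 / (K : ℝ)) *
            BinaryMulticast.entropy (p.map fun s => s ⟨0, by omega⟩ + s ⟨1, by omega⟩))
        ≤ BinaryMulticast.capacity p ∧
      BinaryMulticast.capacity p ≤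
        1 - 1 / (K : ℝ) * BinaryMulticast.entropy
          (p.map fun s (k : {k : Fin K // k ≠ ⟨0, by omega⟩}) => s ⟨0, by omega⟩ + s k)) ∧
    -- i.i.d. interferences with a fixed law, many receivers
    (∀ q : PMF (ZMod 2),
      Tendsto (fun K : ℕ => BinaryMulticast.capacity (BinaryMulticast.iidLaw K q)) atTop
        (𝓝 (1 - BinaryMulticast.entropy q))) ∧
    -- i.i.d. `B(1/2)` interferences: the capacity is `1 / K`, and time-sharing attains it
    (∀ (K : ℕ) (_ : 1 ≤ K) (q : PMF (ZMod 2)), q 1 = 1 / 2 →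
      IsLUB (BinaryMulticast.achievableRates (BinaryMulticast.iidLaw K q)) (1 / (K : ℝ)) ∧
      BinaryMulticast.capacity (BinaryMulticast.iidLaw K q) = 1 / (K : ℝ) ∧
      IsLUB (BinaryMulticast.timeSharingRates (BinaryMulticast.iidLaw K q)) (1 / (K : ℝ))) := by
  refine ⟨fun K hK p hp => ?_, BinaryMulticast.tendsto_capacity_iidLaw, fun K hK q hq => ?_⟩
  · have hsymm : BinaryMulticast.IsSymmetric p := by
      rcases hp with ⟨q, rfl⟩ | hp
      exacts [BinaryMulticast.isSymmetric_iidLaw K q, hp]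
    exact ⟨BinaryMulticast.isLUB_capacity (by omega) p,
      BinaryMulticast.le_capacity (by omega) (fun k => hsymm.map_eval k _)
        fun k k' h => hsymm.map_add h (by simp),
      BinaryMulticast.capacity_le _ p⟩
  · have hpos : (0 : ℝ) < 1 / K := by
      have : (0 : ℝ) < K := by exact_mod_cast hK
      positivity
    have hlub : IsLUB (BinaryMulticast.achievableRates (BinaryMulticast.iidLaw K q))
        (1 / (K : ℝ)) :=
      BinaryMulticast.isLUB_of_lt_of_le hpos
        (fun _ => BinaryMulticast.le_inv_of_mem_achievableRates_uniform hK hq)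
        fun _ h0 h => BinaryMulticast.timeSharingRates_subset _
          (BinaryMulticast.mem_timeSharingRates_of_uniform hK hq h0 h)
    exact ⟨hlub, (BinaryMulticast.isLUB_capacity hK _).unique hlub,
      BinaryMulticast.isLUB_of_lt_of_le hpos
        (fun _ h => hlub.1 (BinaryMulticast.timeSharingRates_subset _ h))
        fun _ => BinaryMulticast.mem_timeSharingRates_of_uniform hK hq⟩
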